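/- Let $(\Omega,\mathcal F,\mathbb P)$ be a probability space with a filtration $(\mathcal F_t)_{t=0}^T$, let $\alpha\in(0,1)$, and let $(Z_t)_{t=1}^T$ be identically distributed random variables with mean $0$ and variance $1$ such that $Z_t$ is $\mathcal F_t$-measurable and independent of $\mathcal F_{t-1}$. Assume that the distribution function $F_Z$ is continuous and strictly increasing on $\mathbb R$, that $Z$ is symmetric, and that $F_Z^{-1}(\alpha)>0$, where $F^{-1}(u)=\inf\{x: F(x)\ge u\}$. Let $(L_t)_{t=0}^T$ be the GARCH$(1,1)$ loss process $$L_t=\sigma_t Z_t,\qquad \sigma_t^2=a_0+a_1L_{t-1}^2+b\,\sigma_{t-1}^2,\qquad \sigma_t\ge 0,\qquad t=1,\dots,T,$$ with $a_0,a_1,b>0$ and $\mathcal F_0$-measurable $\sigma_0, L_0$ (all equalities and inequalities hold almost surely). For a real random variable $X$ put $\mathrm{VaR}^u_t(X)=\operatorname{ess\,inf}\{f : f\ \mathcal F_t\text{-measurable},\ \mathbb P(X\le f\mid\mathcal F_t)\ge u\}$ for $u\in(0,1)$, and, if $\mathbb E[|X|\mid\mathcal F_t]<\infty$, $\mathrm{AVaR}_t(X)=\frac1{1-\alpha}\int_\alpha^1\mathrm{VaR}^u_t(X)\,du$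 (the integral being formed with versions that are jointly measurable in $(u,\omega)$). The time-consistent AVaR of $X$ is defined by $\widetilde{\mathrm{AVaR}}_T(X)=X$ and $\widetilde{\mathrm{AVaR}}_t(X)=\mathrm{AVaR}_t\big(\widetilde{\mathrm{AVaR}}_{t+1}(X)\big)$ for $t=T-1,\dots,0$. Put $\kappa=\frac1{1-\alpha}\int_\alpha^1F_Z^{-1}(u)\,du$, $\kappa_2=\frac1{1-\alpha}\int_\alpha^1F_{Z^2}^{-1}(u)\,du$ and, for $0\le t<s\le T$, $$\mathrm{AVaR}^{\mathrm{up}}_t(L_s)=\kappa\,\sqrt{a_0\sum_{k=0}^{s-t-2}(a_1\kappa_2+b)^k+\sigma_{t+1}^2\,(a_1\kappa_2+b)^{s-t-1}}.$$ Then for all integers $t\ge1$ and $m\ge 1$ with $t+m\le T$ the time-consistent AVaR of the aggregated loss $\sum_{k=1}^m L_{t+k}$ is well defined, and $$\widetilde{\mathrm{AVaR}}_t\Big(\sum_{k=1}^m L_{t+k}\Big)\le\sum_{k=1}^m\mathrm{AVaR}^{\mathrm{up}}_t(L_{t+k})\qquad\text{almost surely.}$$ -/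

import Mathlib

open MeasureTheory ProbabilityTheory Filter
open scoped ENNReal

noncomputable section

namespace GarchAVaR

variable {Ω : Type*} {mΩ : MeasurableSpace Ω}

/-- The left-continuous quantile function `F⁻¹(u) = inf {x : F(x) ≥ u}` of a law `ν` on `ℝ`. -/
def quantile (ν : Measure ℝ) (u : ℝ) : ℝ := sInf {x : ℝ | u ≤ cdf ν x}

/-- The law of `Z²` when `Z` has law `ν`. -/
def sqLaw (ν : Measure ℝ) : Measure ℝ := ν.map (fun z => z ^ 2)

/-- The static Average Value-at-Risk `(1 - α)⁻¹ ∫_α^1 F⁻¹(u) du` of a law `ν` on `ℝ`. -/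
def avarLaw (ν : Measure ℝ) (α : ℝ) : ℝ := (1 - α)⁻¹ * ∫ u in α..1, quantile ν u

/-- `V` is (a version of) the essential infimum of the family `S` of real random variables:
the greatest random variable, up to null sets, that is almost surely below every member of `S`. -/
structure IsEssInf (μ : Measure Ω) (S : Set (Ω → ℝ)) (V : Ω → ℝ) : Prop where
  measurable : Measurable V
  le : ∀ f ∈ S, V ≤ᵐ[μ] f
  greatest : ∀ W : Ω → ℝ, Measurable W → (∀ f ∈ S, W ≤ᵐ[μ] f) → W ≤ᵐ[μ] V

/-- The `m`-measurable thresholds `f` with `ℙ(X ≤ f | m) ≥ u` almost surely. -/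
def varThresholds (μ : Measure Ω) (m : MeasurableSpace Ω) (u : ℝ) (X : Ω → ℝ) : Set (Ω → ℝ) :=
  {f | Measurable[m] f ∧ ∀ᵐ ω ∂μ, u ≤ (μ[({ω | X ω ≤ f ω}).indicator (fun _ => (1 : ℝ)) | m]) ω}

/-- `V` is (a version of) the conditional Value-at-Risk of the loss `X` at level `u` given the
σ-algebra `m`, that is `ess inf {f ∈ L⁰(m) : ℙ(X ≤ f | m) ≥ u}`. -/
structure IsCondVaR (μ : Measure Ω) (m : MeasurableSpace Ω) (u : ℝ) (X V : Ω → ℝ) : Prop where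
  measurable : Measurable[m] V
  isEssInf : IsEssInf μ (varThresholds μ m u X) V

/-- `X` is conditionally integrable given `m`: `𝔼[|X| | m] < ∞` almost surely. -/
def CondIntegrable (μ : Measure Ω) (m : MeasurableSpace Ω) (X : Ω → ℝ) : Prop :=
  ∀ᵐ ω ∂μ, condLExp m μ (fun ω => ‖X ω‖ₑ) ω < ∞

/-- `Y` is (a version of) the conditional Average Value-at-Risk
`(1 - α)⁻¹ ∫_α^1 VaR^u(X) du` of the conditionally integrable loss `X` given `m`. For each level
`u` the conditional Value-at-Risk is only determined up to a null set; the integral over `u` is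
formed with versions that are jointly measurable in `(u, ω)`, which makes `Y` unique up to a null
set. -/
def IsCondAVaR (μ : Measure Ω) (m : MeasurableSpace Ω) (α : ℝ) (X Y : Ω → ℝ) : Prop :=
  CondIntegrable μ m X ∧ Measurable[m] Y ∧
  ∃ V : ℝ → Ω → ℝ,
    Measurable[Real.measurableSpace.prod mΩ] (fun p : ℝ × Ω => V p.1 p.2) ∧
    (∀ u ∈ Set.Ioo α 1, IsCondVaR μ m u X (V u)) ∧
    (∀ᵐ ω ∂μ, IntervalIntegrable (fun u => V u ω) volume α 1) ∧
    ∀ᵐ ω ∂μ, Y ω = (1 - α)⁻¹ * ∫ u in α..1, V u ω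

/-- `Φ 0, …, Φ T` is (a version of) the time-consistent Average Value-at-Risk process at level `α`
of the loss `X`, given by the backward iteration `Φ T = X` and `Φ s = AVaR_s (Φ (s + 1))`. -/
structure IsTimeConsistentAVaR (μ : Measure Ω) (ℱ : Filtration ℕ mΩ) (T : ℕ) (α : ℝ)
    (X : Ω → ℝ) (Φ : ℕ → Ω → ℝ) : Prop where
  measurable_terminal : Measurable[ℱ T] (Φ T)
  terminal : Φ T =ᵐ[μ] X
  step : ∀ s < T, IsCondAVaR μ (ℱ s) α (Φ (s + 1)) (Φ s)

/-- `Z 1, …, Z T` is a strict white noise with one-dimensional law `ν`, relative to the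
filtration: centred, with unit variance, identically distributed, adapted, and `Z (s + 1)`
independent of the past `ℱ s` (in particular, the `Z s` are mutually independent). -/
structure IsWhiteNoise (μ : Measure Ω) (ℱ : Filtration ℕ mΩ) (T : ℕ) (ν : Measure ℝ)
    (Z : ℕ → Ω → ℝ) : Prop where
  adapted : ∀ s, 1 ≤ s → s ≤ T → Measurable[ℱ s] (Z s)
  law : ∀ s, 1 ≤ s → s ≤ T → HasLaw (Z s) ν μ
  indep : ∀ s < T, Indep (MeasurableSpace.comap (Z (s + 1)) inferInstance) (ℱ s) μ
  mean : ∫ z, z ∂ν = 0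
  variance : ∫ z, z ^ 2 ∂ν = 1

/-- Standing assumptions on the innovation law at level `α`: the distribution function is
continuous and strictly increasing (so the support is `ℝ`), the law is symmetric, and
the `α`-quantile is positive. -/
structure InnovationAssumptions (ν : Measure ℝ) (α : ℝ) : Prop where
  strictMono : StrictMono (cdf ν)
  continuous : Continuous (cdf ν)
  symmetric : ν.map (fun z => -z) = ν
  quantile_pos : 0 < quantile ν α

/-- `(L, σ)` follows the GARCH(1,1) recursion `L_s = σ_s Z_s`,
`σ_s² = a₀ + a₁ L_{s-1}² + b σ_{s-1}²` for `s = 1, …, T`, with nonnegative volatility and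
initial values measurable at time `0`. -/
structure IsGARCH (μ : Measure Ω) (ℱ : Filtration ℕ mΩ) (T : ℕ) (a₀ a₁ b : ℝ)
    (Z σ L : ℕ → Ω → ℝ) : Prop where
  measurable_vol_zero : Measurable[ℱ 0] (σ 0)
  measurable_loss_zero : Measurable[ℱ 0] (L 0)
  vol_nonneg : ∀ s < T, ∀ᵐ ω ∂μ, 0 ≤ σ (s + 1) ω
  loss_eq : ∀ s < T, ∀ᵐ ω ∂μ, L (s + 1) ω = σ (s + 1) ω * Z (s + 1) ω
  vol_eq : ∀ s < T, ∀ᵐ ω ∂μ,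
    σ (s + 1) ω ^ 2 = a₀ + a₁ * L s ω ^ 2 + b * σ s ω ^ 2

/-- The random polynomial
`𝒫_t^s(x) = a₀ ∑_{k=0}^{s-t-2} x^k + σ_{t+1}² x^{s-t-1}` for `t < s`. -/
def volPoly (a₀ : ℝ) (σ : ℕ → Ω → ℝ) (t s : ℕ) (x : ℝ) (ω : Ω) : ℝ :=
  a₀ * ∑ k ∈ Finset.range (s - t - 1), x ^ k + σ (t + 1) ω ^ 2 * x ^ (s - t - 1)

/-- The Jensen upper bound at time `t` for the single day loss `L_s`, `t < s`:
`AVaR(Z) · √(𝒫_t^s(a₁ AVaR(Z²) + b))`. -/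
def avarUp (ν : Measure ℝ) (α a₀ a₁ b : ℝ) (σ : ℕ → Ω → ℝ) (t s : ℕ) (ω : Ω) : ℝ :=
  avarLaw ν α * √(volPoly a₀ σ t s (a₁ * avarLaw (sqLaw ν) α + b) ω)

end GarchAVaR

end

noncomputable section

namespace GarchAVaR

/-! The pair (weighted loss so far, next day's volatility) is Markov, driven by innovations
independent of the past. Conditional AVaR therefore becomes static AVaR with the state frozen
(`isCondAVaR_avarLaw`), and the backward iteration gives a deterministic function `garchValue` of
the state. This settles existence; `IsTimeConsistentAVaR.ae_eq` carries the estimate to every other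
version.

The estimate is a backward induction (`avarLaw_garchStep_bounds`). Suppose the value is at most the
accumulated loss plus κ times a sum of square roots of forecast variances. One day earlier each root
is a concave function of `z ^ 2`, so it lies below its tangent at κ₂ = AVaR(Z²). The resulting bound
is quadratic in `z` with nonnegative coefficients of `z` and `z ^ 2`, and subadditivity of AVaR
(`avarLaw_map_le_of_le_quadratic`) replaces `z` by κ and `z ^ 2` by κ₂. At κ₂ the tangent returns
the root itself, now with one more iterate of x ↦ a₀ + (a₁κ₂ + b)x. -/

/-! ### Quantiles and the static Average Value-at-Risk. -/

lemma quantile_le_iff (ρ : Measure ℝ) {u : ℝ} (hu : u ∈ Set.Ioo (0 : ℝ) 1) (x : ℝ) :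
    quantile ρ u ≤ x ↔ u ≤ cdf ρ x := by
  have hbdd : BddBelow {x : ℝ | u ≤ cdf ρ x} := by
    obtain ⟨a, ha⟩ := ((tendsto_cdf_atBot ρ).eventually_lt_const hu.1).exists
    refine ⟨a, fun y hy => ?_⟩
    by_contra! hlt
    exact absurd (hy.trans (monotone_cdf ρ hlt.le)) (not_le.2 ha)
  have hne : {x : ℝ | u ≤ cdf ρ x}.Nonempty := by
    obtain ⟨a, ha⟩ := ((tendsto_cdf_atTop ρ).eventually_const_lt hu.2).exists
    exact ⟨a, ha.le⟩
  refine ⟨fun h => ?_, fun h => csInf_le hbdd h⟩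
  -- Right continuity of the distribution function carries the inequality from all `y > x` to `x`.
  have hgt : ∀ y, x < y → u ≤ cdf ρ y := by
    intro y hy
    obtain ⟨a, ha, hay⟩ := exists_lt_of_csInf_lt hne (h.trans_lt hy)
    exact le_trans ha (monotone_cdf ρ hay.le)
  have hright : Tendsto (cdf ρ) (nhdsWithin x (Set.Ioi x)) (nhds (cdf ρ x)) :=
    ((cdf ρ).right_continuous x).mono_left (nhdsWithin_mono _ Set.Ioi_subset_Ici_self)
  exact ge_of_tendsto hright (eventually_nhdsWithin_of_forall hgt)

lemma quantile_mono (ρ : Measure ℝ) {u v : ℝ} (hu : u ∈ Set.Ioo (0 : ℝ) 1)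
    (hv : v ∈ Set.Ioo (0 : ℝ) 1) (huv : u ≤ v) : quantile ρ u ≤ quantile ρ v :=
  (quantile_le_iff ρ hu _).2 (huv.trans ((quantile_le_iff ρ hv _).1 le_rfl))

/-- By `quantile_le_iff` the sublevel sets are given by distribution functions. That equivalence
needs levels in (0, 1), hence the indicator. -/
lemma measurable_indicator_quantile_uncurry {E : Type*} [MeasurableSpace E] {ρ : E → Measure ℝ}
    (hρ : ∀ x, Measurable fun e => cdf (ρ e) x) :
    Measurable fun p : ℝ × E => (Set.Ioo (0 : ℝ) 1).indicator (quantile (ρ p.2)) p.1 := by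
  refine measurable_of_Iic fun x => ?_
  have hset : (fun p : ℝ × E => (Set.Ioo (0 : ℝ) 1).indicator (quantile (ρ p.2)) p.1) ⁻¹' Set.Iic x
      = (Prod.fst ⁻¹' Set.Ioo (0 : ℝ) 1 ∩ {p : ℝ × E | p.1 ≤ cdf (ρ p.2) x})
        ∪ ((Prod.fst ⁻¹' Set.Ioo (0 : ℝ) 1)ᶜ ∩ {_p : ℝ × E | 0 ≤ x}) := by
    ext p
    by_cases hp : p.1 ∈ Set.Ioo (0 : ℝ) 1
    · simp only [Set.mem_preimage, Set.indicator_of_mem hp, Set.mem_Iic, quantile_le_iff _ hp,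
        Set.mem_union, Set.mem_inter_iff, hp, true_and, Set.mem_ofPred_eq, Set.mem_compl_iff,
        not_true_eq_false, false_and, or_false]
    · simp only [Set.mem_preimage, Set.indicator_of_notMem hp, Set.mem_Iic,
        Set.mem_union, Set.mem_inter_iff, hp, false_and, Set.mem_ofPred_eq, Set.mem_compl_iff,
        not_false_eq_true, true_and, false_or]
  rw [hset]
  have hI : MeasurableSet (Prod.fst ⁻¹' Set.Ioo (0 : ℝ) 1 : Set (ℝ × E)) :=
    measurable_fst measurableSet_Ioo
  exact (hI.inter (measurableSet_le measurable_fst ((hρ x).comp measurable_snd))).union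
    (hI.compl.inter (MeasurableSet.const _))

lemma measurable_indicator_quantile (ρ : Measure ℝ) :
    Measurable ((Set.Ioo (0 : ℝ) 1).indicator (quantile ρ)) :=
  (measurable_indicator_quantile_uncurry (E := Unit) (ρ := fun _ => ρ)
    fun _ => measurable_const).comp (measurable_id.prodMk (measurable_const (a := ())))

/-- The quantile function transports the uniform law on `(0, 1)` to `ρ`. -/
lemma map_indicator_quantile (ρ : Measure ℝ) [IsProbabilityMeasure ρ] :
    (volume.restrict (Set.Ioo (0 : ℝ) 1)).map ((Set.Ioo (0 : ℝ) 1).indicator (quantile ρ)) = ρ := by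
  have : IsProbabilityMeasure (volume.restrict (Set.Ioo (0 : ℝ) 1)) := ⟨by simp⟩
  have := Measure.isProbabilityMeasure_map (μ := volume.restrict (Set.Ioo (0 : ℝ) 1))
    (measurable_indicator_quantile ρ).aemeasurable
  refine Measure.ext_of_Iic _ _ fun x => ?_
  rw [Measure.map_apply (measurable_indicator_quantile ρ) measurableSet_Iic,
    Measure.restrict_apply ((measurable_indicator_quantile ρ) measurableSet_Iic), ← ofReal_cdf]
  have h1 : (Set.Ioo (0 : ℝ) 1).indicator (quantile ρ) ⁻¹' Set.Iic x ∩ Set.Ioo 0 1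
      = Set.Ioo 0 1 ∩ Set.Iic (cdf ρ x) := by
    ext u
    simp only [Set.mem_inter_iff, Set.mem_preimage, Set.mem_Iic]
    constructor
    · rintro ⟨h, hu⟩
      rw [Set.indicator_of_mem hu, quantile_le_iff ρ hu] at h
      exact ⟨hu, h⟩
    · rintro ⟨hu, h⟩
      rw [Set.indicator_of_mem hu, quantile_le_iff ρ hu]
      exact ⟨h, hu⟩
  rw [h1]
  apply le_antisymm
  · calc volume (Set.Ioo 0 1 ∩ Set.Iic (cdf ρ x)) ≤ volume (Set.Ioc 0 (cdf ρ x)) :=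
          measure_mono fun u hu => ⟨hu.1.1, hu.2⟩
      _ = _ := by simp
  · calc ENNReal.ofReal (cdf ρ x) = volume (Set.Ioo 0 (cdf ρ x)) := by simp
      _ ≤ volume (Set.Ioo 0 1 ∩ Set.Iic (cdf ρ x)) :=
          measure_mono fun u hu => ⟨⟨hu.1, hu.2.trans_le (cdf_le_one ρ x)⟩, hu.2.le⟩

lemma integral_comp_quantile (ρ : Measure ℝ) [IsProbabilityMeasure ρ] {φ : ℝ → ℝ}
    (hφ : Measurable φ) : ∫ u in Set.Ioo (0 : ℝ) 1, φ (quantile ρ u) = ∫ y, φ y ∂ρ := by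
  conv_rhs => rw [← map_indicator_quantile ρ]
  rw [integral_map (measurable_indicator_quantile ρ).aemeasurable hφ.aestronglyMeasurable]
  refine setIntegral_congr_fun measurableSet_Ioo fun u hu => ?_
  simp only [Set.indicator_of_mem hu]

lemma integrableOn_comp_quantile (ρ : Measure ℝ) [IsProbabilityMeasure ρ] {φ : ℝ → ℝ}
    (hφ : Measurable φ) (hint : Integrable φ ρ) :
    IntegrableOn (fun u => φ (quantile ρ u)) (Set.Ioo (0 : ℝ) 1) := by
  rw [← map_indicator_quantile ρ,
    integrable_map_measure hφ.aestronglyMeasurable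
      (measurable_indicator_quantile ρ).aemeasurable] at hint
  refine (integrableOn_congr_fun (fun u hu => ?_) measurableSet_Ioo).1 hint
  simp only [Function.comp, Set.indicator_of_mem hu]

lemma intervalIntegral_eq_Ioo {α : ℝ} (hα : α ≤ 1) (f : ℝ → ℝ) :
    ∫ u in α..1, f u = ∫ u in Set.Ioo α 1, f u := by
  rw [intervalIntegral.integral_of_le hα, integral_Ioc_eq_integral_Ioo]

lemma intervalIntegrable_quantile (ρ : Measure ℝ) [IsProbabilityMeasure ρ]
    (hint : Integrable (fun y => y) ρ) {α : ℝ} (hα : α ∈ Set.Ioo (0 : ℝ) 1) :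
    IntervalIntegrable (quantile ρ) volume α 1 := by
  rw [intervalIntegrable_iff_integrableOn_Ioo_of_le hα.2.le]
  exact (integrableOn_comp_quantile ρ measurable_id hint).mono_set
    (Set.Ioo_subset_Ioo_left hα.1.le)

/-- Rockafellar–Uryasev upper bound for the Average Value-at-Risk. -/
lemma avarLaw_le (ρ : Measure ℝ) [IsProbabilityMeasure ρ] (hint : Integrable (fun y => y) ρ)
    {α : ℝ} (hα : α ∈ Set.Ioo (0 : ℝ) 1) (x : ℝ) :
    avarLaw ρ α ≤ x + (1 - α)⁻¹ * ∫ y, max (y - x) 0 ∂ρ := by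
  have h1α : 0 < 1 - α := sub_pos.2 hα.2
  have hsub : Set.Ioo α 1 ⊆ Set.Ioo (0 : ℝ) 1 := Set.Ioo_subset_Ioo_left hα.1.le
  have hmeas : Measurable fun y : ℝ => max (y - x) 0 := by fun_prop
  have hp : IntegrableOn (fun u => max (quantile ρ u - x) 0) (Set.Ioo (0 : ℝ) 1) :=
    integrableOn_comp_quantile ρ hmeas ((hint.sub (integrable_const x)).pos_part)
  have hq : IntegrableOn (quantile ρ) (Set.Ioo α 1) :=
    (integrableOn_comp_quantile ρ measurable_id hint).mono_set hsub
  have hc : IntegrableOn (fun _ : ℝ => x) (Set.Ioo α 1) := by simp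
  have key : ∫ u in Set.Ioo α 1, quantile ρ u ≤ (1 - α) * x + ∫ y, max (y - x) 0 ∂ρ := by
    calc ∫ u in Set.Ioo α 1, quantile ρ u
        ≤ ∫ u in Set.Ioo α 1, (x + max (quantile ρ u - x) 0) :=
          integral_mono hq (hc.add (hp.mono_set hsub)) fun u => by
            have := le_max_left (quantile ρ u - x) 0
            simp only
            linarith
      _ = (1 - α) * x + ∫ u in Set.Ioo α 1, max (quantile ρ u - x) 0 := by
          rw [integral_add hc (hp.mono_set hsub)]
          simp [h1α.le]
      _ ≤ (1 - α) * x + ∫ u in Set.Ioo (0 : ℝ) 1, max (quantile ρ u - x) 0 := by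
          gcongr 1
          exact setIntegral_mono_set hp (ae_of_all _ fun u => le_max_right _ _)
            hsub.eventuallyLE
      _ = _ := by rw [integral_comp_quantile ρ hmeas]
  rw [avarLaw, intervalIntegral_eq_Ioo hα.2.le]
  calc (1 - α)⁻¹ * ∫ u in Set.Ioo α 1, quantile ρ u
      ≤ (1 - α)⁻¹ * ((1 - α) * x + ∫ y, max (y - x) 0 ∂ρ) := by gcongr
    _ = _ := by field_simp

/-- The Rockafellar–Uryasev bound is attained at the `α`-quantile. -/
lemma avarLaw_eq (ρ : Measure ℝ) [IsProbabilityMeasure ρ] (hint : Integrable (fun y => y) ρ)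
    {α : ℝ} (hα : α ∈ Set.Ioo (0 : ℝ) 1) :
    avarLaw ρ α
      = quantile ρ α + (1 - α)⁻¹ * ∫ y, max (y - quantile ρ α) 0 ∂ρ := by
  have h1α : 0 < 1 - α := sub_pos.2 hα.2
  have hsub : Set.Ioo α 1 ⊆ Set.Ioo (0 : ℝ) 1 := Set.Ioo_subset_Ioo_left hα.1.le
  set x := quantile ρ α with hx
  have hmeas : Measurable fun y : ℝ => max (y - x) 0 := by fun_prop
  have hq : IntegrableOn (quantile ρ) (Set.Ioo α 1) :=
    (integrableOn_comp_quantile ρ measurable_id hint).mono_set hsub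
  have hc : IntegrableOn (fun _ : ℝ => x) (Set.Ioo α 1) := by simp
  -- By monotonicity of the quantile, the positive part is `quantile ρ u - x` for `u > α` and
  -- vanishes for `u ≤ α`.
  have key : ∫ y, max (y - x) 0 ∂ρ = (∫ u in Set.Ioo α 1, quantile ρ u) - (1 - α) * x := by
    rw [← integral_comp_quantile ρ hmeas,
      setIntegral_eq_of_subset_of_forall_sdiff_eq_zero measurableSet_Ioo hsub]
    · rw [setIntegral_congr_fun (g := fun u => quantile ρ u - x) measurableSet_Ioo]
      · rw [integral_sub hq hc]
        simp [h1α.le]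
      · intro u hu
        exact max_eq_left (sub_nonneg.2 (quantile_mono ρ hα (hsub hu) hu.1.le))
    · rintro u ⟨hu, hu'⟩
      refine max_eq_right (sub_nonpos.2 (quantile_mono ρ hu hα ?_))
      by_contra! h
      exact hu' ⟨h, hu.2⟩
  rw [key, avarLaw, intervalIntegral_eq_Ioo hα.2.le]
  field_simp
  ring

/-- Integrate y ≤ x + (y - x)⁺ and use (1 - α)⁻¹ ≥ 1. -/
lemma integral_le_avarLaw (ρ : Measure ℝ) [IsProbabilityMeasure ρ]
    (hint : Integrable (fun y => y) ρ) {α : ℝ} (hα : α ∈ Set.Ioo (0 : ℝ) 1) :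
    ∫ y, y ∂ρ ≤ avarLaw ρ α := by
  have h1α : 0 < 1 - α := sub_pos.2 hα.2
  rw [avarLaw_eq ρ hint hα]
  set x := quantile ρ α
  have hp : Integrable (fun y => max (y - x) 0) ρ := (hint.sub (integrable_const x)).pos_part
  have h0 : 0 ≤ ∫ y, max (y - x) 0 ∂ρ := integral_nonneg fun y => le_max_right _ _
  have hone : 1 ≤ (1 - α)⁻¹ := (one_le_inv₀ h1α).2 (by linarith [hα.1])
  calc ∫ y, y ∂ρ ≤ ∫ y, (x + max (y - x) 0) ∂ρ :=
        integral_mono hint ((integrable_const x).add hp) fun y => by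
          have := le_max_left (y - x) 0
          simp only
          linarith
    _ = x + 1 * ∫ y, max (y - x) 0 ∂ρ := by
        rw [integral_add (integrable_const x) hp]; simp
    _ ≤ _ := by gcongr

/-- The Average Value-at-Risk of a loss dominated by a conic combination of `z` and `z ^ 2`,
up to a constant. -/
lemma avarLaw_map_le_of_le_quadratic (ν : Measure ℝ) [IsProbabilityMeasure ν]
    (h1 : Integrable (fun z => z) ν) (h2 : Integrable (fun z => z ^ 2) ν)
    {α : ℝ} (hα : α ∈ Set.Ioo (0 : ℝ) 1) {h : ℝ → ℝ} (hm : Measurable h) (hint : Integrable h ν)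
    {c₀ c₁ c₂ : ℝ} (hc₁ : 0 ≤ c₁) (hc₂ : 0 ≤ c₂) (hle : ∀ z, h z ≤ c₀ + c₁ * z + c₂ * z ^ 2) :
    avarLaw (ν.map h) α ≤ c₀ + c₁ * avarLaw ν α + c₂ * avarLaw (sqLaw ν) α := by
  have h1α : 0 < 1 - α := sub_pos.2 hα.2
  have hsq : Measurable fun z : ℝ => z ^ 2 := by fun_prop
  have := Measure.isProbabilityMeasure_map (μ := ν) hm.aemeasurable
  have : IsProbabilityMeasure (sqLaw ν) :=
    Measure.isProbabilityMeasure_map (μ := ν) hsq.aemeasurable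
  have hint' : Integrable (fun y => y) (ν.map h) :=
    (integrable_map_measure measurable_id.aestronglyMeasurable hm.aemeasurable).2 hint
  have h2' : Integrable (fun y => y) (sqLaw ν) :=
    (integrable_map_measure measurable_id.aestronglyMeasurable hsq.aemeasurable).2 h2
  rw [avarLaw_eq ν h1 hα, avarLaw_eq (sqLaw ν) h2' hα]
  set x₁ := quantile ν α
  set x₂ := quantile (sqLaw ν) α
  have hp {x : ℝ} : Measurable fun y : ℝ => max (y - x) 0 := by fun_prop
  have hI {g : ℝ → ℝ} (hg : Integrable g ν) (x : ℝ) :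
      Integrable (fun z => max (g z - x) 0) ν := (hg.sub (integrable_const x)).pos_part
  -- Taking the same combination of the two quantiles as threshold lets the positive part split
  -- termwise.
  refine (avarLaw_le _ hint' hα (c₀ + c₁ * x₁ + c₂ * x₂)).trans ?_
  rw [integral_map hm.aemeasurable hp.aestronglyMeasurable, sqLaw,
    integral_map hsq.aemeasurable hp.aestronglyMeasurable]
  have key : ∫ z, max (h z - (c₀ + c₁ * x₁ + c₂ * x₂)) 0 ∂ν
      ≤ c₁ * (∫ z, max (z - x₁) 0 ∂ν) + c₂ * ∫ z, max (z ^ 2 - x₂) 0 ∂ν := by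
    rw [← integral_const_mul, ← integral_const_mul,
      ← integral_add ((hI h1 _).const_mul _) ((hI h2 _).const_mul _)]
    refine integral_mono (hI hint _) (((hI h1 _).const_mul _).add ((hI h2 _).const_mul _))
      fun z => ?_
    have e1 := mul_le_mul_of_nonneg_left (le_max_left (z - x₁) 0) hc₁
    have e2 := mul_le_mul_of_nonneg_left (le_max_left (z ^ 2 - x₂) 0) hc₂
    have f1 := mul_nonneg hc₁ (le_max_right (z - x₁) 0)
    have f2 := mul_nonneg hc₂ (le_max_right (z ^ 2 - x₂) 0)
    refine max_le ?_ (add_nonneg f1 f2)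
    have := hle z
    simp only
    linarith
  calc c₀ + c₁ * x₁ + c₂ * x₂ + (1 - α)⁻¹ * ∫ z, max (h z - (c₀ + c₁ * x₁ + c₂ * x₂)) 0 ∂ν
      ≤ c₀ + c₁ * x₁ + c₂ * x₂ + (1 - α)⁻¹ *
        (c₁ * (∫ z, max (z - x₁) 0 ∂ν) + c₂ * ∫ z, max (z ^ 2 - x₂) 0 ∂ν) := by gcongr
    _ = _ := by ring

/-! ### Conditional risk measures by freezing the past, and their uniqueness. -/

section Conditional

variable {Ω : Type*} {m mΩ : MeasurableSpace Ω}

section Parametric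

variable {E : Type*} [MeasurableSpace E] {ν : Measure ℝ} [IsProbabilityMeasure ν] {f : E × ℝ → ℝ}

lemma cdf_map_eq (hf : Measurable f) (e : E) (x : ℝ) :
    cdf (ν.map fun z => f (e, z)) x = ν.real {z | f (e, z) ≤ x} := by
  have hfe : Measurable fun z => f (e, z) := hf.comp measurable_prodMk_left
  have := Measure.isProbabilityMeasure_map (μ := ν) hfe.aemeasurable
  rw [cdf_eq_real, measureReal_def, Measure.map_apply hfe measurableSet_Iic]
  rfl

lemma measurable_cdf_map (hf : Measurable f) (x : ℝ) :
    Measurable fun e => cdf (ν.map fun z => f (e, z)) x := by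
  simp only [cdf_map_eq hf]
  exact (measurable_measure_prodMk_left (ν := ν)
    (measurableSet_le hf (measurable_const (a := x)))).ennreal_toReal

lemma measurable_quantile_map (hf : Measurable f) {u : ℝ} (hu : u ∈ Set.Ioo (0 : ℝ) 1) :
    Measurable fun e => quantile (ν.map fun z => f (e, z)) u := by
  have h := (measurable_indicator_quantile_uncurry (measurable_cdf_map (ν := ν) hf)).comp
    (measurable_prodMk_left (x := u))
  simpa only [Function.comp_def, Set.indicator_of_mem hu] using h

lemma measurable_avarLaw_map (hf : Measurable f) {α : ℝ} (hα : α ∈ Set.Ioo (0 : ℝ) 1) :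
    Measurable fun e => avarLaw (ν.map fun z => f (e, z)) α := by
  have h := (measurable_indicator_quantile_uncurry
    (measurable_cdf_map (ν := ν) hf)).stronglyMeasurable.integral_prod_left'
    (μ := volume.restrict (Set.Ioo α 1))
  have heq : (fun e => avarLaw (ν.map fun z => f (e, z)) α) = fun e => (1 - α)⁻¹ *
      ∫ u in Set.Ioo α 1, (Set.Ioo (0 : ℝ) 1).indicator (quantile (ν.map fun z => f (e, z))) u := by
    ext e
    rw [avarLaw, intervalIntegral_eq_Ioo hα.2.le]
    congr 1
    refine setIntegral_congr_fun measurableSet_Ioo fun u hu => ?_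
    rw [Set.indicator_of_mem (Set.Ioo_subset_Ioo_left hα.1.le hu)]
  rw [heq]
  exact h.measurable.const_mul _

variable {μ : Measure Ω} [IsProbabilityMeasure μ] {W : Ω → E} {Z : Ω → ℝ}

/-- Independence survives restriction to any event of `m`, so Fubini computes integrals over the
events that characterise conditional expectation. -/
lemma map_restrict_prodMk_eq_prod (hm : m ≤ mΩ) (hW : Measurable[m] W) (hZm : Measurable Z)
    (hZ : HasLaw Z ν μ) (hind : Indep (MeasurableSpace.comap Z inferInstance) m μ)
    {s : Set Ω} (hs : MeasurableSet[m] s) :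
    (μ.restrict s).map (fun ω => (W ω, Z ω)) = ((μ.restrict s).map W).prod ν := by
  have hW' : Measurable W := hW.mono hm le_rfl
  symm
  refine Measure.prod_eq fun A B hA hB => ?_
  rw [Measure.map_apply (hW'.prodMk hZm) (hA.prod hB), Measure.map_apply hW' hA,
    Measure.restrict_apply ((hW'.prodMk hZm) (hA.prod hB)), Measure.restrict_apply (hW' hA),
    ← hZ.map_eq, Measure.map_apply hZm hB, mul_comm,
    ← (Indep_iff _ _ _).1 hind _ _ ⟨B, hB, rfl⟩ (MeasurableSet.inter (hW hA) hs)]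
  congr 1
  ext ω
  simp only [Set.mem_inter_iff, Set.mem_preimage, Set.mem_prod]
  tauto

/-- Freezing lemma: conditionally on `m`, integrate out a variable independent of `m`. -/
lemma condLExp_freezing (hm : m ≤ mΩ) (hW : Measurable[m] W) (hZm : Measurable Z)
    (hZ : HasLaw Z ν μ) (hind : Indep (MeasurableSpace.comap Z inferInstance) m μ)
    {F : E × ℝ → ℝ≥0∞} (hF : Measurable F) :
    (fun ω => ∫⁻ z, F (W ω, z) ∂ν) =ᵐ[μ] condLExp m μ (fun ω => F (W ω, Z ω)) := by
  have hW' : Measurable W := hW.mono hm le_rfl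
  refine ae_eq_condLExp hm μ _ (hF.lintegral_prod_right'.comp hW) fun s hs => ?_
  rw [← lintegral_map hF (hW'.prodMk hZm), map_restrict_prodMk_eq_prod hm hW hZm hZ hind hs,
    lintegral_prod _ hF.aemeasurable, lintegral_map hF.lintegral_prod_right' hW']

/-- The threshold `g` is itself `m`-measurable, so it is frozen together with `W`. -/
lemma condExp_indicator_le_ae_eq (hm : m ≤ mΩ) (hW : Measurable[m] W) (hZm : Measurable Z)
    (hZ : HasLaw Z ν μ) (hind : Indep (MeasurableSpace.comap Z inferInstance) m μ)
    (hf : Measurable f) {g : Ω → ℝ} (hg : Measurable[m] g) :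
    μ[({ω | f (W ω, Z ω) ≤ g ω}).indicator (fun _ => (1 : ℝ)) | m]
      =ᵐ[μ] fun ω => cdf (ν.map fun z => f (W ω, z)) (g ω) := by
  let A : Set ((E × ℝ) × ℝ) := {p | f (p.1.1, p.2) ≤ p.1.2}
  have hA : MeasurableSet A := measurableSet_le (by fun_prop) (by fun_prop)
  have hWg : Measurable[m] fun ω => (W ω, g ω) := hW.prodMk hg
  have hF : Measurable (A.indicator fun _ => (1 : ℝ≥0∞)) := measurable_const.indicator hA
  have hmeas : Measurable fun ω => A.indicator (fun _ => (1 : ℝ≥0∞)) ((W ω, g ω), Z ω) :=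
    hF.comp ((hWg.mono hm le_rfl).prodMk hZm)
  have hfin : ∫⁻ ω, A.indicator (fun _ => (1 : ℝ≥0∞)) ((W ω, g ω), Z ω) ∂μ ≠ ∞ := by
    refine ne_of_lt (lt_of_le_of_lt (lintegral_mono (g := fun _ => 1) fun ω => ?_) (by simp))
    exact Set.indicator_le_self' (by simp) _
  have hreal := toReal_condLExp m hmeas.aemeasurable hfin
  have hfreeze := condLExp_freezing hm hWg hZm hZ hind hF
  have hfun : (fun ω => (A.indicator (fun _ => (1 : ℝ≥0∞)) ((W ω, g ω), Z ω)).toReal)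
      = ({ω | f (W ω, Z ω) ≤ g ω}).indicator (fun _ => (1 : ℝ)) := by
    ext ω
    by_cases h : f (W ω, Z ω) ≤ g ω
    · rw [Set.indicator_of_mem (show _ ∈ A from h), Set.indicator_of_mem (by exact h)]; simp
    · rw [Set.indicator_of_notMem (show _ ∉ A from h), Set.indicator_of_notMem (by exact h)]; simp
  rw [hfun] at hreal
  filter_upwards [hreal, hfreeze] with ω h1 h2
  rw [← h1, ← h2, cdf_map_eq hf, measureReal_def]
  congr 1
  have hAω : MeasurableSet {z | f (W ω, z) ≤ g ω} :=
    measurableSet_le (hf.comp measurable_prodMk_left) measurable_const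
  rw [← lintegral_indicator_one hAω]
  rfl

/-- The essential infimum is attained: the frozen quantile is an admissible threshold and lies below
all others. -/
lemma isCondVaR_quantile (hm : m ≤ mΩ) (hW : Measurable[m] W) (hZm : Measurable Z)
    (hZ : HasLaw Z ν μ) (hind : Indep (MeasurableSpace.comap Z inferInstance) m μ)
    (hf : Measurable f) {u : ℝ} (hu : u ∈ Set.Ioo (0 : ℝ) 1) :
    IsCondVaR μ m u (fun ω => f (W ω, Z ω)) (fun ω => quantile (ν.map fun z => f (W ω, z)) u) := by
  have hV : Measurable[m] fun ω => quantile (ν.map fun z => f (W ω, z)) u :=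
    (measurable_quantile_map hf hu).comp hW
  refine ⟨hV, hV.mono hm le_rfl, ?_, ?_⟩
  · rintro g ⟨hg, hgu⟩
    filter_upwards [hgu, condExp_indicator_le_ae_eq hm hW hZm hZ hind hf hg] with ω h1 h2
    rw [quantile_le_iff _ hu, ← h2]
    exact h1
  · intro V' _ hV'
    refine hV' _ ⟨hV, ?_⟩
    filter_upwards [condExp_indicator_le_ae_eq hm hW hZm hZ hind hf hV] with ω h
    rw [h, ← quantile_le_iff _ hu]

/-- The conditional Average Value-at-Risk of `f (W, Z)`, for `W` known at `m` and `Z` independent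
of `m`, is the static Average Value-at-Risk with `W` frozen. -/
lemma isCondAVaR_avarLaw (hm : m ≤ mΩ) (hW : Measurable[m] W) (hZm : Measurable Z)
    (hZ : HasLaw Z ν μ) (hind : Indep (MeasurableSpace.comap Z inferInstance) m μ)
    (hf : Measurable f) (hint : ∀ ω, Integrable (fun z => f (W ω, z)) ν)
    {α : ℝ} (hα : α ∈ Set.Ioo (0 : ℝ) 1) :
    IsCondAVaR μ m α (fun ω => f (W ω, Z ω)) (fun ω => avarLaw (ν.map fun z => f (W ω, z)) α) := by
  have hsub : Set.Ioo α 1 ⊆ Set.Ioo (0 : ℝ) 1 := Set.Ioo_subset_Ioo_left hα.1.le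
  -- The indicator makes the family jointly measurable and changes nothing at levels in (α, 1).
  refine ⟨?_, (measurable_avarLaw_map hf hα).comp hW,
    fun u ω => (Set.Ioo (0 : ℝ) 1).indicator (quantile (ν.map fun z => f (W ω, z))) u,
    ?_, ?_, ?_, ?_⟩
  · filter_upwards [condLExp_freezing hm hW hZm hZ hind hf.enorm] with ω h
    rw [← h]
    exact (hint ω).2
  · exact (measurable_indicator_quantile_uncurry (measurable_cdf_map (ν := ν) hf)).comp
      (measurable_fst.prodMk ((hW.mono hm le_rfl).comp measurable_snd))
  · intro u hu
    simp only [Set.indicator_of_mem (hsub hu)]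
    exact isCondVaR_quantile hm hW hZm hZ hind hf (hsub hu)
  · refine ae_of_all _ fun ω => ?_
    have hfω : Measurable fun z => f (W ω, z) := hf.comp measurable_prodMk_left
    have := Measure.isProbabilityMeasure_map (μ := ν) hfω.aemeasurable
    have hq := intervalIntegrable_quantile (ν.map fun z => f (W ω, z))
      ((integrable_map_measure measurable_id.aestronglyMeasurable hfω.aemeasurable).2 (hint ω)) hα
    rw [intervalIntegrable_iff_integrableOn_Ioo_of_le hα.2.le] at hq ⊢
    exact hq.congr_fun (fun u hu => (Set.indicator_of_mem (hsub hu) _).symm) measurableSet_Ioo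
  · refine ae_of_all _ fun ω => ?_
    simp only [avarLaw, intervalIntegral_eq_Ioo hα.2.le]
    congr 1
    exact setIntegral_congr_fun measurableSet_Ioo
      fun u hu => (Set.indicator_of_mem (hsub hu) _).symm

end Parametric

lemma varThresholds_congr {μ : Measure Ω} {u : ℝ} {X X' : Ω → ℝ}
    (h : X =ᵐ[μ] X') : varThresholds μ m u X = varThresholds μ m u X' := by
  ext g
  refine and_congr_right fun _ => ?_
  have hcond : μ[({ω | X ω ≤ g ω}).indicator (fun _ => (1 : ℝ)) | m]
      =ᵐ[μ] μ[({ω | X' ω ≤ g ω}).indicator (fun _ => (1 : ℝ)) | m] := by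
    refine condExp_congr_ae ?_
    filter_upwards [h] with ω hω
    simp only [Set.indicator_apply, Set.mem_ofPred_eq, hω]
  constructor <;> intro hle <;> filter_upwards [hle, hcond] with ω h1 h2
  · rwa [← h2]
  · rwa [h2]

lemma IsCondVaR.ae_eq {μ : Measure Ω} {u : ℝ} {X X' V V' : Ω → ℝ}
    (h : IsCondVaR μ m u X V) (h' : IsCondVaR μ m u X' V') (hX : X =ᵐ[μ] X') : V =ᵐ[μ] V' := by
  have h1 := h.isEssInf
  have h2 := h'.isEssInf
  rw [← varThresholds_congr hX] at h2
  exact (h2.greatest V h1.measurable h1.le).antisymm (h1.greatest V' h2.measurable h2.le)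

/-- The null set where two versions of VaR differ depends on the level; joint measurability allows
Fubini to exchange the quantifiers. -/
lemma IsCondAVaR.ae_eq {μ : Measure Ω} [SFinite μ] {α : ℝ} (hα : α ≤ 1)
    {X X' Y Y' : Ω → ℝ} (h : IsCondAVaR μ m α X Y) (h' : IsCondAVaR μ m α X' Y')
    (hX : X =ᵐ[μ] X') : Y =ᵐ[μ] Y' := by
  obtain ⟨-, -, V, hVm, hV, -, hY⟩ := h
  obtain ⟨-, -, V', hVm', hV', -, hY'⟩ := h'
  have hprod : ∀ᵐ u ∂(volume.restrict (Set.Ioo α 1)), ∀ᵐ ω ∂μ, V u ω = V' u ω := by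
    filter_upwards [ae_restrict_mem measurableSet_Ioo] with u hu
    exact (hV u hu).ae_eq (hV' u hu) hX
  have hswap : ∀ᵐ ω ∂μ, ∀ᵐ u ∂(volume.restrict (Set.Ioo α 1)), V u ω = V' u ω :=
    (Measure.ae_ae_comm (p := fun u ω => V u ω = V' u ω) (measurableSet_eq_fun hVm hVm')).1 hprod
  filter_upwards [hY, hY', hswap] with ω h1 h2 h3
  rw [h1, h2, intervalIntegral_eq_Ioo hα, intervalIntegral_eq_Ioo hα, integral_congr_ae h3]

lemma IsTimeConsistentAVaR.ae_eq {μ : Measure Ω} [SFinite μ] {ℱ : Filtration ℕ mΩ} {T : ℕ} {α : ℝ}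
    (hα : α ≤ 1) {X : Ω → ℝ} {Φ Ψ : ℕ → Ω → ℝ} (hΦ : IsTimeConsistentAVaR μ ℱ T α X Φ)
    (hΨ : IsTimeConsistentAVaR μ ℱ T α X Ψ) {s : ℕ} (hs : s ≤ T) : Φ s =ᵐ[μ] Ψ s := by
  induction hs using Nat.decreasingInduction with
  | self => exact hΦ.terminal.trans hΨ.terminal.symm
  | of_succ s hs ih => exact (hΦ.step s hs).ae_eq hα (hΨ.step s hs) ih

end Conditional

/-! ### The value function and its bounds. -/

/-- One day of the GARCH recursion for the state (weighted accumulated loss, volatility of the next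
day): the loss of the day is added with weight `w` and the volatility is updated. -/
def garchStep (a₀ a₁ b w : ℝ) (p : ℝ × ℝ) (z : ℝ) : ℝ × ℝ :=
  (p.1 + w * (p.2 * z), √(a₀ + a₁ * (p.2 * z) ^ 2 + b * p.2 ^ 2))

lemma measurable_garchStep (a₀ a₁ b w : ℝ) :
    Measurable fun x : (ℝ × ℝ) × ℝ => garchStep a₀ a₁ b w x.1 x.2 := by
  unfold garchStep
  fun_prop

/-- The time-consistent Average Value-at-Risk, as a function of the current state, of the
accumulated loss after `r` further days, where the `i`-th of these days has weight `w i`. -/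
def garchValue (ν : Measure ℝ) (α a₀ a₁ b : ℝ) : ℕ → (ℕ → ℝ) → ℝ × ℝ → ℝ
  | 0, _, p => p.1
  | r + 1, w, p => avarLaw
      (ν.map fun z => garchValue ν α a₀ a₁ b r (fun i => w (i + 1)) (garchStep a₀ a₁ b (w 0) p z)) α

lemma measurable_garchValue (ν : Measure ℝ) [IsProbabilityMeasure ν] {α : ℝ}
    (hα : α ∈ Set.Ioo (0 : ℝ) 1) (a₀ a₁ b : ℝ) (r : ℕ) (w : ℕ → ℝ) :
    Measurable (garchValue ν α a₀ a₁ b r w) := by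
  induction r generalizing w with
  | zero => exact measurable_fst
  | succ r ih =>
    exact measurable_avarLaw_map ((ih fun i => w (i + 1)).comp (measurable_garchStep a₀ a₁ b (w 0)))
      hα

/-- The tangent line of the square root at `q ^ 2`. -/
lemma sqrt_le_tangent {q d : ℝ} (hq : 0 < q) (hd : 0 ≤ q ^ 2 + d) :
    √(q ^ 2 + d) ≤ q + d / (2 * q) := by
  have heq : q + d / (2 * q) = (q ^ 2 + (q ^ 2 + d)) / (2 * q) := by
    field_simp
    ring
  rw [heq, le_div_iff₀ (by positivity)]
  nlinarith [sq_nonneg (√(q ^ 2 + d) - q), Real.sq_sqrt hd]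

/-- The variance after `i` further days when the squared innovations are replaced by a constant:
iterates of `x ↦ a₀ + c x`. -/
def varPoly (a₀ c : ℝ) (i : ℕ) (x : ℝ) : ℝ := a₀ * ∑ k ∈ Finset.range i, c ^ k + x * c ^ i

/-- The first iterate is peeled off, since a backward step changes the starting variance. -/
lemma varPoly_succ (a₀ c x : ℝ) (i : ℕ) : varPoly a₀ c (i + 1) x = varPoly a₀ c i (a₀ + c * x) := by
  simp only [varPoly, Finset.sum_range_succ, pow_succ]
  ring

lemma varPoly_add (a₀ c x y : ℝ) (i : ℕ) :
    varPoly a₀ c i (x + y) = varPoly a₀ c i x + y * c ^ i := by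
  simp only [varPoly]
  ring

lemma varPoly_pos {a₀ c x : ℝ} (ha₀ : 0 < a₀) (hc : 0 < c) (hx : 0 < x) (i : ℕ) :
    0 < varPoly a₀ c i x := by
  have : 0 ≤ ∑ k ∈ Finset.range i, c ^ k := Finset.sum_nonneg fun k _ => (pow_pos hc k).le
  unfold varPoly
  positivity

section Bounds

variable {ν : Measure ℝ} [IsProbabilityMeasure ν] {α a₀ a₁ b : ℝ}

/-- The variance is affine in `z ^ 2`; this is the tangent at `z ^ 2 = k`, where the forecast gains
exactly one iterate. -/
lemma sqrt_varPoly_le {c k : ℝ} (ha₀ : 0 < a₀) (ha₁ : 0 < a₁) (hb : 0 < b) (hc : 0 < c)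
    (hck : c = a₁ * k + b) (i : ℕ) (v z : ℝ) :
    √(varPoly a₀ c i (a₀ + a₁ * (v * z) ^ 2 + b * v ^ 2)) ≤ √(varPoly a₀ c (i + 1) (v ^ 2))
      + a₁ * v ^ 2 * c ^ i / (2 * √(varPoly a₀ c (i + 1) (v ^ 2))) * (z ^ 2 - k) := by
  have hpos : 0 < varPoly a₀ c (i + 1) (v ^ 2) := by
    rw [varPoly_succ]
    exact varPoly_pos ha₀ hc (by positivity) i
  have heq : varPoly a₀ c i (a₀ + a₁ * (v * z) ^ 2 + b * v ^ 2)
      = √(varPoly a₀ c (i + 1) (v ^ 2)) ^ 2 + a₁ * v ^ 2 * (z ^ 2 - k) * c ^ i := by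
    rw [Real.sq_sqrt hpos.le, varPoly_succ, ← varPoly_add, hck]
    congr 1
    ring
  have hnonneg : 0 ≤ varPoly a₀ c i (a₀ + a₁ * (v * z) ^ 2 + b * v ^ 2) :=
    (varPoly_pos ha₀ hc (by positivity) i).le
  rw [heq] at hnonneg ⊢
  refine (sqrt_le_tangent (Real.sqrt_pos.2 hpos) hnonneg).trans (le_of_eq ?_)
  ring

/-- One backward step: bounds of a value function by the accumulated loss, from below, and by a
combination of square roots of variances, from above, propagate one day back. -/
lemma avarLaw_garchStep_bounds (hα : α ∈ Set.Ioo (0 : ℝ) 1) (h1 : Integrable (fun z => z) ν)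
    (h2 : Integrable (fun z => z ^ 2) ν) (hmean : ∫ z, z ∂ν = 0) (hκ : 0 ≤ avarLaw ν α)
    (hκ₂ : 0 ≤ avarLaw (sqLaw ν) α) (ha₀ : 0 < a₀) (ha₁ : 0 < a₁) (hb : 0 < b)
    {G : ℝ × ℝ → ℝ} (hG : Measurable G) {r : ℕ} {w : ℕ → ℝ} (hw : ∀ i, 0 ≤ w i)
    (hbd : ∀ p : ℝ × ℝ, 0 ≤ p.2 → p.1 ≤ G p ∧ G p ≤ p.1 + avarLaw ν α *
      ∑ i ∈ Finset.range r, w i * √(varPoly a₀ (a₁ * avarLaw (sqLaw ν) α + b) i (p.2 ^ 2)))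
    {w₀ : ℝ} (hw₀ : 0 ≤ w₀) (p : ℝ × ℝ) (hp : 0 ≤ p.2) :
    Integrable (fun z => G (garchStep a₀ a₁ b w₀ p z)) ν ∧
    p.1 ≤ avarLaw (ν.map fun z => G (garchStep a₀ a₁ b w₀ p z)) α ∧
    avarLaw (ν.map fun z => G (garchStep a₀ a₁ b w₀ p z)) α ≤ p.1 + avarLaw ν α *
      (∑ i ∈ Finset.range r, w i * √(varPoly a₀ (a₁ * avarLaw (sqLaw ν) α + b) (i + 1) (p.2 ^ 2))
        + w₀ * p.2) := by
  set κ := avarLaw ν α with hκ_def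
  set κ₂ := avarLaw (sqLaw ν) α with hκ₂_def
  set c := a₁ * κ₂ + b with hc_def
  have hc : 0 < c := by positivity
  set h : ℝ → ℝ := fun z => G (garchStep a₀ a₁ b w₀ p z) with hh
  have hm : Measurable h := hG.comp
    ((measurable_garchStep a₀ a₁ b w₀).comp measurable_prodMk_left)
  have hbd' : ∀ z, _ := fun z => hbd (garchStep a₀ a₁ b w₀ p z) (Real.sqrt_nonneg _)
  -- With `hup` this gives integrability; with mean zero it gives the lower bound by `p.1`.
  have hlow : ∀ z, p.1 + w₀ * p.2 * z ≤ h z := fun z => by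
    have := (hbd' z).1
    simp only [garchStep] at this
    simp only [hh, garchStep]
    linarith
  set q : ℕ → ℝ := fun i => √(varPoly a₀ c (i + 1) (p.2 ^ 2)) with hq
  set d : ℕ → ℝ := fun i => a₁ * p.2 ^ 2 * c ^ i / (2 * q i) with hd
  have hd0 : ∀ i, 0 ≤ d i := fun i => by positivity
  -- Used at `y = z ^ 2` to read off the quadratic, and at `y = κ₂`, where the correction cancels.
  have hsplit : ∀ y, ∑ i ∈ Finset.range r, w i * (q i + d i * (y - κ₂))
      = ∑ i ∈ Finset.range r, w i * (q i - d i * κ₂)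
        + (∑ i ∈ Finset.range r, w i * d i) * y := fun y => by
    rw [Finset.sum_mul, ← Finset.sum_add_distrib]
    exact Finset.sum_congr rfl fun i _ => by ring
  have hup : ∀ z, h z ≤ (p.1 + κ * ∑ i ∈ Finset.range r, w i * (q i - d i * κ₂))
      + w₀ * p.2 * z + (κ * ∑ i ∈ Finset.range r, w i * d i) * z ^ 2 := by
    intro z
    have hsum : ∑ i ∈ Finset.range r, w i *
          √(varPoly a₀ c i ((garchStep a₀ a₁ b w₀ p z).2 ^ 2))
        ≤ ∑ i ∈ Finset.range r, w i * (q i + d i * (z ^ 2 - κ₂)) := by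
      refine Finset.sum_le_sum fun i _ => mul_le_mul_of_nonneg_left ?_ (hw _)
      rw [garchStep, Real.sq_sqrt (by positivity)]
      exact sqrt_varPoly_le ha₀ ha₁ hb hc hc_def i p.2 z
    calc h z ≤ _ := (hbd' z).2
      _ ≤ p.1 + w₀ * (p.2 * z)
          + κ * ∑ i ∈ Finset.range r, w i * (q i + d i * (z ^ 2 - κ₂)) :=
        add_le_add le_rfl (mul_le_mul_of_nonneg_left hsum hκ)
      _ = _ := by
        rw [hsplit]
        ring
  have hlow_int : Integrable (fun z => p.1 + w₀ * p.2 * z) ν :=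
    (integrable_const _).add (h1.const_mul _)
  have hint : Integrable h ν := integrable_of_le_of_le hm.aestronglyMeasurable (ae_of_all _ hlow)
    (ae_of_all _ hup) hlow_int
    (((integrable_const _).add (h1.const_mul _)).add (h2.const_mul _))
  refine ⟨hint, ?_, ?_⟩
  · have := Measure.isProbabilityMeasure_map (μ := ν) hm.aemeasurable
    refine le_trans ?_ (integral_le_avarLaw (ν.map h) ((integrable_map_measure
      measurable_id.aestronglyMeasurable hm.aemeasurable).2 hint) hα)
    rw [integral_map (f := fun y => y) hm.aemeasurable aestronglyMeasurable_id]
    calc p.1 = ∫ z, (p.1 + w₀ * p.2 * z) ∂ν := by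
          rw [integral_add (integrable_const _) (h1.const_mul _), integral_const_mul, hmean]
          simp
      _ ≤ _ := integral_mono hlow_int hint hlow
  · refine (avarLaw_map_le_of_le_quadratic ν h1 h2 hα hm hint (mul_nonneg hw₀ hp)
      (mul_nonneg hκ (Finset.sum_nonneg fun i _ => mul_nonneg (hw i) (hd0 i))) hup).trans
      (le_of_eq ?_)
    have := hsplit κ₂
    simp only [sub_self, mul_zero, add_zero] at this
    rw [← hκ_def, ← hκ₂_def, this]
    ring

/-- The lower bound travels along because integrability at each step needs a two-sided estimate. The
weights are generalised since each step shifts them. -/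
lemma garchValue_bounds (hα : α ∈ Set.Ioo (0 : ℝ) 1) (h1 : Integrable (fun z => z) ν)
    (h2 : Integrable (fun z => z ^ 2) ν) (hmean : ∫ z, z ∂ν = 0) (hκ : 0 ≤ avarLaw ν α)
    (hκ₂ : 0 ≤ avarLaw (sqLaw ν) α) (ha₀ : 0 < a₀) (ha₁ : 0 < a₁) (hb : 0 < b)
    (r : ℕ) {w : ℕ → ℝ} (hw : ∀ i, 0 ≤ w i) (p : ℝ × ℝ) (hp : 0 ≤ p.2) :
    p.1 ≤ garchValue ν α a₀ a₁ b r w p ∧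
    garchValue ν α a₀ a₁ b r w p ≤ p.1 + avarLaw ν α *
      ∑ i ∈ Finset.range r, w i * √(varPoly a₀ (a₁ * avarLaw (sqLaw ν) α + b) i (p.2 ^ 2)) := by
  induction r generalizing w p with
  | zero => simp [garchValue]
  | succ r ih =>
    have hstep := (avarLaw_garchStep_bounds hα h1 h2 hmean hκ hκ₂ ha₀ ha₁ hb
      (measurable_garchValue ν hα a₀ a₁ b r _) (fun i => hw (i + 1))
      (fun p hp => ih (fun i => hw (i + 1)) p hp) (hw 0) p hp).2
    -- The next day's loss is the term of index 0, whose forecast variance is already known.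
    have hzero : √(varPoly a₀ (a₁ * avarLaw (sqLaw ν) α + b) 0 (p.2 ^ 2)) = p.2 := by
      simp [varPoly, Real.sqrt_sq hp]
    rw [Finset.sum_range_succ', hzero]
    exact hstep

lemma integrable_garchValue_garchStep (hα : α ∈ Set.Ioo (0 : ℝ) 1) (h1 : Integrable (fun z => z) ν)
    (h2 : Integrable (fun z => z ^ 2) ν) (hmean : ∫ z, z ∂ν = 0) (hκ : 0 ≤ avarLaw ν α)
    (hκ₂ : 0 ≤ avarLaw (sqLaw ν) α) (ha₀ : 0 < a₀) (ha₁ : 0 < a₁) (hb : 0 < b)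
    (r : ℕ) {w : ℕ → ℝ} (hw : ∀ i, 0 ≤ w i) {w₀ : ℝ} (hw₀ : 0 ≤ w₀) (p : ℝ × ℝ) (hp : 0 ≤ p.2) :
    Integrable (fun z => garchValue ν α a₀ a₁ b r w (garchStep a₀ a₁ b w₀ p z)) ν :=
  (avarLaw_garchStep_bounds hα h1 h2 hmean hκ hκ₂ ha₀ ha₁ hb
    (measurable_garchValue ν hα a₀ a₁ b r w) hw
    (fun p hp => garchValue_bounds hα h1 h2 hmean hκ hκ₂ ha₀ ha₁ hb r hw p hp) hw₀ p hp).1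

lemma avarLaw_nonneg_of_quantile_nonneg {ρ : Measure ℝ} (hα : α ∈ Set.Ioo (0 : ℝ) 1)
    (hq : 0 ≤ quantile ρ α) : 0 ≤ avarLaw ρ α := by
  rw [avarLaw, intervalIntegral_eq_Ioo hα.2.le]
  refine mul_nonneg (inv_nonneg.2 (sub_nonneg.2 hα.2.le))
    (setIntegral_nonneg measurableSet_Ioo fun u hu => ?_)
  exact hq.trans (quantile_mono ρ hα ⟨hα.1.trans hu.1, hu.2⟩ hu.1.le)

lemma avarLaw_sqLaw_nonneg (hα : α ∈ Set.Ioo (0 : ℝ) 1) (h2 : Integrable (fun z => z ^ 2) ν) :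
    0 ≤ avarLaw (sqLaw ν) α := by
  have hsq : Measurable fun z : ℝ => z ^ 2 := by fun_prop
  have : IsProbabilityMeasure (sqLaw ν) :=
    Measure.isProbabilityMeasure_map (μ := ν) hsq.aemeasurable
  refine le_trans ?_ (integral_le_avarLaw (sqLaw ν) ((integrable_map_measure
    measurable_id.aestronglyMeasurable hsq.aemeasurable).2 h2) hα)
  rw [sqLaw, integral_map (f := fun y => y) hsq.aemeasurable aestronglyMeasurable_id]
  exact integral_nonneg fun z => sq_nonneg z

end Bounds

/-! ### The state process and its link to the GARCH model. -/

section StateDynamics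

variable {Ω : Type*} {mΩ : MeasurableSpace Ω}

/-- The state process of a GARCH model driven by `Z` and started from `L₀`, `σ₀`: at time `s` the
sum of the losses up to time `s` with weights `w`, and the volatility of day `s + 1`. -/
def garchState (a₀ a₁ b : ℝ) (w : ℕ → ℝ) (Z : ℕ → Ω → ℝ) (L₀ σ₀ : Ω → ℝ) : ℕ → Ω → ℝ × ℝ
  | 0, ω => (0, √(a₀ + a₁ * L₀ ω ^ 2 + b * σ₀ ω ^ 2))
  | s + 1, ω => garchStep a₀ a₁ b (w s) (garchState a₀ a₁ b w Z L₀ σ₀ s ω) (Z (s + 1) ω)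

lemma garchState_snd_nonneg (a₀ a₁ b : ℝ) (w : ℕ → ℝ) (Z : ℕ → Ω → ℝ) (L₀ σ₀ : Ω → ℝ) (s : ℕ)
    (ω : Ω) : 0 ≤ (garchState a₀ a₁ b w Z L₀ σ₀ s ω).2 := by
  cases s <;> exact Real.sqrt_nonneg _

lemma measurable_garchState {ℱ : Filtration ℕ mΩ} {T : ℕ} {Z : ℕ → Ω → ℝ} {L₀ σ₀ : Ω → ℝ}
    (hZ : ∀ s, 1 ≤ s → s ≤ T → Measurable[ℱ s] (Z s)) (hL₀ : Measurable[ℱ 0] L₀)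
    (hσ₀ : Measurable[ℱ 0] σ₀) (a₀ a₁ b : ℝ) (w : ℕ → ℝ) {s : ℕ} (hs : s ≤ T) :
    Measurable[ℱ s] (garchState a₀ a₁ b w Z L₀ σ₀ s) := by
  induction s with
  | zero =>
    have hg : Measurable fun x : ℝ × ℝ => ((0 : ℝ), √(a₀ + a₁ * x.1 ^ 2 + b * x.2 ^ 2)) := by
      fun_prop
    exact hg.comp (hL₀.prodMk hσ₀)
  | succ s ih =>
    exact (measurable_garchStep a₀ a₁ b (w s)).comp
      (((ih (by omega)).mono (ℱ.mono s.le_succ) le_rfl).prodMk (hZ (s + 1) (by omega) hs))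

/-- `garchState` obeys the recursion everywhere and is exactly adapted, whereas the model is only
constrained almost surely. Volatilities are matched for `s < T` only, as day `T + 1` is outside the
model. -/
lemma IsGARCH.garchState_eq {μ : Measure Ω} {ℱ : Filtration ℕ mΩ} {T : ℕ} {a₀ a₁ b : ℝ}
    {Z σ L : ℕ → Ω → ℝ} (h : IsGARCH μ ℱ T a₀ a₁ b Z σ L) (w : ℕ → ℝ) :
    ∀ᵐ ω ∂μ, (∀ s < T, (garchState a₀ a₁ b w Z (L 0) (σ 0) s ω).2 = σ (s + 1) ω) ∧
      ∀ s ≤ T, (garchState a₀ a₁ b w Z (L 0) (σ 0) s ω).1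
        = ∑ j ∈ Finset.range s, w j * L (j + 1) ω := by
  have h1 : ∀ᵐ ω ∂μ, ∀ s < T, 0 ≤ σ (s + 1) ω :=
    ae_all_iff.2 fun s => eventually_imp_distrib_left.2 (h.vol_nonneg s)
  have h2 : ∀ᵐ ω ∂μ, ∀ s < T, L (s + 1) ω = σ (s + 1) ω * Z (s + 1) ω :=
    ae_all_iff.2 fun s => eventually_imp_distrib_left.2 (h.loss_eq s)
  have h3 : ∀ᵐ ω ∂μ, ∀ s < T, σ (s + 1) ω ^ 2 = a₀ + a₁ * L s ω ^ 2 + b * σ s ω ^ 2 :=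
    ae_all_iff.2 fun s => eventually_imp_distrib_left.2 (h.vol_eq s)
  filter_upwards [h1, h2, h3] with ω h1 h2 h3
  have hvol : ∀ s < T, (garchState a₀ a₁ b w Z (L 0) (σ 0) s ω).2 = σ (s + 1) ω := by
    intro s hs
    induction s with
    | zero => rw [garchState, ← h3 0 hs, Real.sqrt_sq (h1 0 hs)]
    | succ s ih =>
      rw [garchState, garchStep, ih (by omega), ← h2 s (by omega), ← h3 (s + 1) hs,
        Real.sqrt_sq (h1 (s + 1) hs)]
  refine ⟨hvol, fun s hs => ?_⟩
  induction s with
  | zero => simp [garchState]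
  | succ s ih =>
    rw [garchState, garchStep, ih (by omega), hvol s hs, ← h2 s hs, Finset.sum_range_succ]

/-- The time-consistent Average Value-at-Risk of a weighted sum of GARCH losses. -/
lemma isTimeConsistentAVaR_garchValue {μ : Measure Ω} [IsProbabilityMeasure μ] {ℱ : Filtration ℕ mΩ}
    {T : ℕ} {α a₀ a₁ b : ℝ} (hα : α ∈ Set.Ioo (0 : ℝ) 1) {ν : Measure ℝ} [IsProbabilityMeasure ν]
    {Z σ L : ℕ → Ω → ℝ} (hZ : IsWhiteNoise μ ℱ T ν Z) (hL : IsGARCH μ ℱ T a₀ a₁ b Z σ L)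
    (h1 : Integrable (fun z => z) ν) (h2 : Integrable (fun z => z ^ 2) ν)
    (hκ : 0 ≤ avarLaw ν α) (ha₀ : 0 < a₀) (ha₁ : 0 < a₁) (hb : 0 < b)
    {w : ℕ → ℝ} (hw : ∀ i, 0 ≤ w i) :
    IsTimeConsistentAVaR μ ℱ T α (fun ω => ∑ j ∈ Finset.range T, w j * L (j + 1) ω)
      fun s ω => garchValue ν α a₀ a₁ b (T - s) (fun i => w (s + i))
        (garchState a₀ a₁ b w Z (L 0) (σ 0) s ω) := by
  have hstate : ∀ s ≤ T, Measurable[ℱ s] (garchState a₀ a₁ b w Z (L 0) (σ 0) s) := fun s hs =>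
    measurable_garchState hZ.adapted hL.measurable_loss_zero hL.measurable_vol_zero a₀ a₁ b w hs
  refine ⟨(measurable_garchValue ν hα a₀ a₁ b _ _).comp (hstate T le_rfl), ?_, fun s hs => ?_⟩
  · filter_upwards [hL.garchState_eq w] with ω hω
    rw [Nat.sub_self]
    exact hω.2 T le_rfl
  · have hstep := isCondAVaR_avarLaw (ν := ν) (ℱ.le s) (hstate s hs.le)
      ((hZ.adapted (s + 1) (by omega) hs).mono (ℱ.le _) le_rfl) (hZ.law (s + 1) (by omega) hs)
      (hZ.indep s hs)
      ((measurable_garchValue ν hα a₀ a₁ b (T - (s + 1)) fun i => w (s + 1 + i)).comp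
        (measurable_garchStep a₀ a₁ b (w s)))
      (fun ω => integrable_garchValue_garchStep hα h1 h2 hZ.mean hκ
        (avarLaw_sqLaw_nonneg hα h2) ha₀ ha₁ hb _ (fun i => hw _) (hw s) _
        (garchState_snd_nonneg a₀ a₁ b w Z (L 0) (σ 0) s ω)) hα
    -- Bring horizon and shifted weights into the form in which `garchValue` unfolds.
    have hr : T - s = T - (s + 1) + 1 := by omega
    have hwi : (fun i => w (s + 1 + i)) = fun i => w (s + (i + 1)) := by
      ext i
      congr 1
      omega
    rw [hwi] at hstep ⊢
    rw [hr]
    exact hstep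

end StateDynamics

end GarchAVaR

end

/-! ### The aggregated loss as a weighted sum. -/

theorem proposition4p9 {Ω : Type*} {mΩ : MeasurableSpace Ω}
    (μ : Measure Ω) [IsProbabilityMeasure μ] (ℱ : Filtration ℕ mΩ) (T : ℕ)
    (α : ℝ) (hα : α ∈ Set.Ioo (0 : ℝ) 1)
    (ν : Measure ℝ) (hν : GarchAVaR.InnovationAssumptions ν α)
    (Z : ℕ → Ω → ℝ) (hZ : GarchAVaR.IsWhiteNoise μ ℱ T ν Z)
    (a₀ a₁ b : ℝ) (ha₀ : 0 < a₀) (ha₁ : 0 < a₁) (hb : 0 < b)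
    (σ L : ℕ → Ω → ℝ) (hL : GarchAVaR.IsGARCH μ ℱ T a₀ a₁ b Z σ L)
    (t m : ℕ) (ht : 1 ≤ t) (hm : 1 ≤ m) (htm : t + m ≤ T) :
    (∃ Φ : ℕ → Ω → ℝ,
      GarchAVaR.IsTimeConsistentAVaR μ ℱ T α
        (fun ω => ∑ k ∈ Finset.Icc 1 m, L (t + k) ω) Φ) ∧
    ∀ Φ : ℕ → Ω → ℝ,
      GarchAVaR.IsTimeConsistentAVaR μ ℱ T α
        (fun ω => ∑ k ∈ Finset.Icc 1 m, L (t + k) ω) Φ →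
      ∀ᵐ ω ∂μ, Φ t ω ≤
        ∑ k ∈ Finset.Icc 1 m, GarchAVaR.avarUp ν α a₀ a₁ b σ t (t + k) ω := by
  open GarchAVaR in
  have hlaw := hZ.law 1 le_rfl (by omega)
  have : IsProbabilityMeasure ν := hlaw.map_eq ▸ Measure.isProbabilityMeasure_map hlaw.aemeasurable
  -- A non-integrable function has integral 0 by convention, which contradicts unit variance.
  have h2 : Integrable (fun z => z ^ 2) ν := by
    by_contra h
    have := hZ.variance
    rw [integral_undef h] at this
    exact zero_ne_one this
  have h1 : Integrable (fun z => z) ν :=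
    ((memLp_two_iff_integrable_sq measurable_id.aestronglyMeasurable).2 h2).integrable (by simp)
  have hκ : 0 ≤ avarLaw ν α := avarLaw_nonneg_of_quantile_nonneg hα hν.quantile_pos.le
  have hκ₂ := avarLaw_sqLaw_nonneg hα h2
  -- `w j` weighs `L (j + 1)`, so this selects days t + 1 to t + m; the loss accumulated by time `t`
  -- is then 0.
  let w : ℕ → ℝ := fun j => if j ∈ Finset.Ico t (t + m) then 1 else 0
  have hw : ∀ j, 0 ≤ w j := fun j => by
    simp only [w]
    split_ifs <;> norm_num
  have hsum : ∀ (n : ℕ) (g : ℕ → ℝ), m ≤ n →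
      ∑ i ∈ Finset.range n, w (t + i) * g i = ∑ k ∈ Finset.Icc 1 m, g (k - 1) := by
    intro n g hmn
    have hr : ∑ k ∈ Finset.Icc 1 m, g (k - 1) = ∑ i ∈ Finset.range m, g i := by
      rw [← Finset.Ico_add_one_right_eq_Icc, Finset.sum_Ico_eq_sum_range]
      simp
    rw [hr, ← Finset.sum_subset (Finset.range_mono hmn)]
    · refine Finset.sum_congr rfl fun i hi => ?_
      have : t + i ∈ Finset.Ico t (t + m) := by simp at hi ⊢; omega
      simp only [w, if_pos this, one_mul]
    · intro i _ hi
      have : t + i ∉ Finset.Ico t (t + m) := by simp at hi ⊢; omega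
      simp only [w, if_neg this, zero_mul]
  have hzero : ∀ g : ℕ → ℝ, ∑ j ∈ Finset.range t, w j * g j = 0 := fun g =>
    Finset.sum_eq_zero fun j hj => by
      have : j ∉ Finset.Ico t (t + m) := by simp at hj ⊢; omega
      simp only [w, if_neg this, zero_mul]
  have hloss : (fun ω => ∑ k ∈ Finset.Icc 1 m, L (t + k) ω)
      = fun ω => ∑ j ∈ Finset.range T, w j * L (j + 1) ω := by
    ext ω
    obtain ⟨n, rfl⟩ := Nat.exists_eq_add_of_le (show t ≤ T by omega)
    rw [Finset.sum_range_add, hzero, zero_add,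
      hsum n (fun i => L (t + i + 1) ω) (by omega)]
    refine Finset.sum_congr rfl fun k hk => ?_
    rw [Finset.mem_Icc] at hk
    rw [show t + (k - 1) + 1 = t + k by omega]
  rw [hloss]
  have hΨ := isTimeConsistentAVaR_garchValue hα hZ hL h1 h2 hκ ha₀ ha₁ hb hw
  refine ⟨⟨_, hΨ⟩, fun Φ hΦ => ?_⟩
  filter_upwards [hΦ.ae_eq hα.2.le hΨ (show t ≤ T by omega), hL.garchState_eq w] with ω h hω
  have hbd := (garchValue_bounds hα h1 h2 hZ.mean hκ hκ₂ ha₀ ha₁ hb (T - t)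
    (fun i => hw (t + i)) (garchState a₀ a₁ b w Z (L 0) (σ 0) t ω)
    (garchState_snd_nonneg a₀ a₁ b w Z (L 0) (σ 0) t ω)).2
  rw [hsum (T - t) _ (by omega), hω.1 t (by omega), hω.2 t (by omega), hzero, zero_add,
    Finset.mul_sum] at hbd
  rw [h]
  refine hbd.trans (le_of_eq (Finset.sum_congr rfl fun k _ => ?_))
  rw [avarUp, volPoly, varPoly, show t + k - t - 1 = k - 1 by omega]
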